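/- Let $\mathbb D$ be the open unit disk and let $\mathcal A$ be the set of all holomorphic functions $f$ on $\mathbb D$ with $f(0)=0$ and $f'(0)=1$. For real $s\ge 0$ and real $t$ put $$\mathfrak A_s^t:=\Big\{f\in\mathcal A:\ \Re\Big[(s-1)\frac{f(z)}{z}+f'(z)\Big]\ge st\ \text{ for all } z\in\mathbb D\setminus\{0\}\Big\},$$ and let $$\xi_0(s):=\int_0^1\frac{1-x}{1+x}\,s\,x^{s-1}\,dx\quad(s>0),\qquad \xi_0(0):=1=\lim_{s\to0^+}\xi_0(s).$$ We say that an inclusion $\mathfrak A_{s}^{t}\subset\mathfrak A_{s'}^{t'}$ is sharp if it holds and $\mathfrak A_{s}^{t}\not\subset\mathfrak A_{s'}^{\tau}$ for every real $\tau>t'$. Theorem. Let $0\le s_1<s_2<\infty$ and $t_1\in[0,1)$. (i) If $t_2=t_1+(1-t_1)\left(1-\frac{s_1}{s_2}\right)\xi_0(s_1)$, then the inclusion $\mathfrak A_{s_1}^{t_1}\subset\mathfrak A_{s_2}^{t_2}$ holds and is sharp. (ii) If $t_2\in\mathbb R$ and $\mathfrak A_{s_1}^{t_1}\subset\mathfrak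 A_{s_2}^{t_2}$, then $t_2\le t_1+(1-t_1)\left(1-\frac{s_1}{s_2}\right)\xi_0(s_1)$; consequently, $(1-t_2)s_2\ge(1-t_1)s_1$. (iii) If $s_0\in[0,s_1)$, $t_0,t_2\in[0,1)$ and $\mathfrak A_{s_0}^{t_0}\subset\mathfrak A_{s_1}^{t_1}\subset\mathfrak A_{s_2}^{t_2}$, then the inclusion $\mathfrak A_{s_0}^{t_0}\subset\mathfrak A_{s_2}^{t_2}$ is not sharp. -/

import Mathlib

open Set

/-- The class `𝒜` of holomorphic functions on the open unit disk with `f 0 = 0`, `f' 0 = 1`.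
A function on the disk is represented by a function `ℂ → ℂ`; its values off the disk play no
role. -/
def normalizedClass : Set (ℂ → ℂ) :=
  {f | DifferentiableOn ℂ f (Metric.ball 0 1) ∧ f 0 = 0 ∧ deriv f 0 = 1}

/-- The class `𝔄_s^t`: all `f ∈ 𝒜` with `Re [(s - 1) f(z)/z + f'(z)] ≥ s t` for every `z ≠ 0`
in the open unit disk. -/
def classA (s t : ℝ) : Set (ℂ → ℂ) :=
  {f | f ∈ normalizedClass ∧
    ∀ z ∈ Metric.ball (0 : ℂ) 1, z ≠ 0 →
      s * t ≤ (((s : ℂ) - 1) * (f z / z) + deriv f z).re}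

/-- `ξ₀(s) = ∫₀¹ (1 - x)/(1 + x) · s x^(s-1) dx` for `s > 0`, extended by continuity
by `ξ₀(0) = 1` (the integral formula itself degenerates at `s = 0`). -/
noncomputable def xi0 (s : ℝ) : ℝ :=
  if s = 0 then 1 else ∫ x in (0 : ℝ)..1, (1 - x) / (1 + x) * (s * x ^ (s - 1))

/-- The inclusion `𝔄_{s₁}^{t₁} ⊆ 𝔄_{s₂}^{t₂}` holds and is sharp: it fails as soon as `t₂` is
replaced by a larger number. -/
def SharpInclusion (s₁ t₁ s₂ t₂ : ℝ) : Prop :=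
  classA s₁ t₁ ⊆ classA s₂ t₂ ∧ ∀ t : ℝ, t₂ < t → ¬ classA s₁ t₁ ⊆ classA s₂ t

/-! Write `f(z) = z p(z)`; membership in `classA s t` says that `g = p + z p'/s` has `Re g ≥ t` (for
`s > 0`). Since `p(z) = ∫₀¹ s x^(s-1) g(xz) dx`, Harnack's inequality gives `Re p ≥ t + (1 - t)
ξ₀(s)` (`xi0_bound_le_re`), and `s₂ p + z p' = s₁ g + (s₂ - s₁) p` yields the inclusion. It is sharp
because `g = t₁ + (1 - t₁)(1 + z)/(1 - z)` approaches equality as `z → -1`. For `s₁ = 0`, `Re p` is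
monotone along radii.

For (iii), two inclusions in a row cost the product of two factors `1 - (1 - s/s') ξ₀(s)`, which
exceeds the direct factor (`sharp_bound_composition_lt`) because `s ξ₀(s) / (1 - ξ₀(s))` decreases.
This quotient is `weightedMoment 2 s / weightedMoment 1 s`, the mean of `1/(1 + x)` for the weight
`x^s/(1 + x)`, which moves to the right as `s` grows. -/

/-! ### Moments, `ξ₀`, and the strict composition inequality. -/

/-- The moments `∫₀¹ x^s / (1 + x)^k dx`. -/
noncomputable def weightedMoment (k : ℕ) (s : ℝ) : ℝ :=
  ∫ x in (0 : ℝ)..1, x ^ s / (1 + x) ^ k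

lemma continuousOn_weightedMoment_integrand (k : ℕ) {s : ℝ} (hs : 0 ≤ s) :
    ContinuousOn (fun x : ℝ => x ^ s / (1 + x) ^ k) (Icc 0 1) := by
  refine ContinuousOn.div (Real.continuous_rpow_const hs).continuousOn (by fun_prop) ?_
  intro x hx
  have := hx.1
  positivity

lemma intervalIntegrable_weightedMoment_integrand (k : ℕ) {s : ℝ} (hs : 0 ≤ s) :
    IntervalIntegrable (fun x : ℝ => x ^ s / (1 + x) ^ k) MeasureTheory.volume 0 1 :=
  (continuousOn_weightedMoment_integrand k hs).intervalIntegrable_of_Icc zero_le_one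

lemma weightedMoment_pos (k : ℕ) {s : ℝ} (hs : 0 ≤ s) : 0 < weightedMoment k s := by
  refine intervalIntegral.intervalIntegral_pos_of_pos_on
    (intervalIntegrable_weightedMoment_integrand k hs) ?_ zero_lt_one
  intro x hx
  have := hx.1
  positivity

lemma weightedMoment_two_lt_one {s : ℝ} (hs : 0 ≤ s) :
    weightedMoment 2 s < weightedMoment 1 s := by
  refine intervalIntegral.integral_lt_integral_of_continuousOn_of_le_of_exists_lt zero_lt_one
    (continuousOn_weightedMoment_integrand 2 hs) (continuousOn_weightedMoment_integrand 1 hs) ?_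
    ⟨1, by simp, by norm_num⟩
  intro x hx
  have hx0 := hx.1
  gcongr
  · linarith
  · norm_num

/-- Integration of the derivative of `2 x^(s+1) / (1 + x)`. -/
lemma one_sub_two_mul_weightedMoment {s : ℝ} (hs : 0 ≤ s) :
    1 - 2 * weightedMoment 2 s = 2 * s * weightedMoment 1 s := by
  have hi := ((intervalIntegrable_weightedMoment_integrand 1 hs).const_mul (2 * s)).add
    ((intervalIntegrable_weightedMoment_integrand 2 hs).const_mul 2)
  have h := intervalIntegral.integral_eq_sub_of_hasDerivAt_of_le
    (f := fun x : ℝ => 2 * x ^ (s + 1) / (1 + x)) zero_le_one ?_ ?_ hi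
  · rw [intervalIntegral.integral_add
      ((intervalIntegrable_weightedMoment_integrand 1 hs).const_mul (2 * s))
      ((intervalIntegrable_weightedMoment_integrand 2 hs).const_mul 2),
      intervalIntegral.integral_const_mul, intervalIntegral.integral_const_mul,
      Real.zero_rpow (by linarith)] at h
    simp only [weightedMoment]
    norm_num at h ⊢
    linarith
  · refine ContinuousOn.div (continuous_const.mul
      (Real.continuous_rpow_const (by linarith))).continuousOn (by fun_prop) ?_
    intro x hx
    have := hx.1
    positivity
  · intro x hx
    have hx0 := hx.1
    have h1 : (1 + x) ≠ 0 := by positivity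
    have hd := ((Real.hasDerivAt_rpow_const (x := x) (p := s + 1) (Or.inl hx0.ne')).const_mul
      2).div ((hasDerivAt_id x).const_add 1) h1
    refine hd.congr_deriv ?_
    rw [add_sub_cancel_right, Real.rpow_add_one hx0.ne']
    simp only [id]
    field_simp
    ring

lemma intervalIntegrable_rpow_weight {s : ℝ} (hs : 0 < s) {φ : ℝ → ℝ}
    (hφ : ContinuousOn φ (Icc 0 1)) :
    IntervalIntegrable (fun x : ℝ => s * x ^ (s - 1) * φ x) MeasureTheory.volume 0 1 := by
  refine IntervalIntegrable.mul_continuousOn ?_ (by simpa using hφ)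
  exact (intervalIntegral.intervalIntegrable_rpow' (by linarith)).const_mul s

lemma integral_rpow_weight {s : ℝ} (hs : 0 < s) :
    ∫ x in (0 : ℝ)..1, s * x ^ (s - 1) = 1 := by
  rw [intervalIntegral.integral_const_mul, integral_rpow (Or.inl (by linarith))]
  simp [Real.zero_rpow hs.ne', hs.ne']

/-- Integration by parts against the weight `s x^(s-1)`. -/
lemma integral_rpow_weight_mul_add {s : ℝ} (hs : 0 < s) {u u' : ℝ → ℝ}
    (hu : ContinuousOn u (Icc 0 1)) (hd : ∀ x ∈ Ioo (0 : ℝ) 1, HasDerivAt u (u' x) x)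
    (hu' : ContinuousOn u' (Icc 0 1)) :
    ∫ x in (0 : ℝ)..1, s * x ^ (s - 1) * (u x + x * u' x / s) = u 1 := by
  have hi := intervalIntegrable_rpow_weight hs (φ := fun x => u x + x * u' x / s) (by fun_prop)
  have h := intervalIntegral.integral_eq_sub_of_hasDerivAt_of_le
    (f := fun x : ℝ => x ^ s * u x) zero_le_one
    ((Real.continuous_rpow_const hs.le).continuousOn.mul hu) ?_ hi
  · simpa [Real.zero_rpow hs.ne'] using h
  · intro x hx
    have hx0 := hx.1
    refine ((Real.hasDerivAt_rpow_const (p := s) (Or.inl hx0.ne')).mul (hd x hx)).congr_deriv ?_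
    have : x ^ s = x ^ (s - 1) * x := by rw [← Real.rpow_add_one hx0.ne']; simp
    rw [this]
    field_simp

lemma continuousOn_one_sub_div_one_add :
    ContinuousOn (fun x : ℝ => (1 - x) / (1 + x)) (Icc 0 1) := by
  refine ContinuousOn.div (by fun_prop) (by fun_prop) ?_
  intro x hx
  have := hx.1
  positivity

lemma xi0_of_pos {s : ℝ} (hs : 0 < s) :
    xi0 s = ∫ x in (0 : ℝ)..1, s * x ^ (s - 1) * ((1 - x) / (1 + x)) := by
  rw [xi0, if_neg hs.ne']
  simp only [mul_comm]

/-- Integration by parts with `u = (1 - x)/(1 + x)`: the boundary term vanishes as `u 1 = 0`, and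
`u' = -2/(1 + x)^2`. -/
lemma xi0_eq_two_mul_weightedMoment {s : ℝ} (hs : 0 ≤ s) : xi0 s = 2 * weightedMoment 2 s := by
  rcases hs.eq_or_lt with rfl | hs
  · have := one_sub_two_mul_weightedMoment le_rfl
    simp only [xi0, if_true]
    linarith
  have hc : ContinuousOn (fun x : ℝ => -2 / (1 + x) ^ 2) (Icc 0 1) := by
    refine ContinuousOn.div (by fun_prop) (by fun_prop) ?_
    intro x hx
    have := hx.1
    positivity
  have h := integral_rpow_weight_mul_add hs continuousOn_one_sub_div_one_add
    (u' := fun x => -2 / (1 + x) ^ 2) ?_ hc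
  · have h2 : ∫ x in (0 : ℝ)..1, s * x ^ (s - 1) * (x * (-2 / (1 + x) ^ 2) / s)
        = -(2 * weightedMoment 2 s) := by
      rw [weightedMoment, ← intervalIntegral.integral_const_mul, ← intervalIntegral.integral_neg]
      refine intervalIntegral.integral_congr fun x hx => ?_
      rw [uIcc_of_le zero_le_one] at hx
      rcases hx.1.eq_or_lt with rfl | hx0
      · simp [Real.zero_rpow hs.ne']
      have : x ^ s = x ^ (s - 1) * x := by rw [← Real.rpow_add_one hx0.ne']; simp
      simp only [this]
      field_simp
    simp only [mul_add] at h
    rw [intervalIntegral.integral_add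
      (intervalIntegrable_rpow_weight hs continuousOn_one_sub_div_one_add)
      (intervalIntegrable_rpow_weight hs (by fun_prop)), h2, ← xi0_of_pos hs] at h
    norm_num at h
    linarith
  · intro x hx
    have hx0 := hx.1
    refine (((hasDerivAt_id x).const_sub 1).div ((hasDerivAt_id x).const_add 1)
      (by simp only [id]; positivity)).congr_deriv ?_
    simp only [id]
    field_simp
    ring

lemma xi0_pos {s : ℝ} (hs : 0 ≤ s) : 0 < xi0 s := by
  have := weightedMoment_pos 2 hs
  rw [xi0_eq_two_mul_weightedMoment hs]
  linarith

lemma one_sub_xi0 {s : ℝ} (hs : 0 ≤ s) : 1 - xi0 s = 2 * s * weightedMoment 1 s := by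
  rw [xi0_eq_two_mul_weightedMoment hs, one_sub_two_mul_weightedMoment hs]

lemma xi0_le_one {s : ℝ} (hs : 0 ≤ s) : xi0 s ≤ 1 := by
  have := weightedMoment_pos 1 hs
  have := one_sub_xi0 hs
  have : 0 ≤ 2 * s * weightedMoment 1 s := by positivity
  linarith

/-- A Chebyshev-type inequality: larger exponents put more weight on larger `x`. -/
lemma weightedMoment_mul_lt {s s' : ℝ} (hs : 0 ≤ s) (hss : s < s') :
    weightedMoment 2 s' * weightedMoment 1 s < weightedMoment 2 s * weightedMoment 1 s' := by
  have hs' : 0 ≤ s' := hs.trans hss.le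
  have hd : 0 < s' - s := sub_pos.2 hss
  have hJ := weightedMoment_pos 2 hs
  have hK := weightedMoment_pos 1 hs
  have hJK := weightedMoment_two_lt_one hs
  set J := weightedMoment 2 s with hJdef
  set K := weightedMoment 1 s with hKdef
  -- `a` is the point where `1/(1 + x)` equals its mean `J / K`. So `1/(1 + x) - J / K` changes sign
  -- at `a`, exactly where `x^(s' - s) - a^(s' - s)` changes sign the other way.
  obtain ⟨a, ha0, ha⟩ : ∃ a : ℝ, 0 < a ∧ J / K = 1 / (1 + a) :=
    ⟨K / J - 1, by rw [sub_pos, one_lt_div hJ]; exact hJK, by rw [add_sub_cancel, one_div_div]⟩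
  have key : ∀ x : ℝ, 0 < x →
      (a ^ (s' - s) * (x ^ s / (1 + x) ^ 2) - a ^ (s' - s) * (J / K) * (x ^ s / (1 + x) ^ 1))
        - (x ^ s' / (1 + x) ^ 2 - J / K * (x ^ s' / (1 + x) ^ 1))
      = x ^ s / (1 + x) ^ 2 / (1 + a) * ((a ^ (s' - s) - x ^ (s' - s)) * (a - x)) := by
    intro x hx
    have : x ^ s' = x ^ s * x ^ (s' - s) := by rw [← Real.rpow_add hx]; simp
    rw [ha, this]
    field_simp
    ring
  have hpos : ∀ x : ℝ, 0 < x → x ≠ a → 0 < (a ^ (s' - s) - x ^ (s' - s)) * (a - x) := by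
    intro x hx hxa
    rcases lt_or_gt_of_ne hxa with h | h
    · exact mul_pos (sub_pos.2 (Real.rpow_lt_rpow hx.le h hd)) (sub_pos.2 h)
    · exact mul_pos_of_neg_of_neg (sub_neg.2 (Real.rpow_lt_rpow ha0.le h hd)) (sub_neg.2 h)
  have hlt := intervalIntegral.integral_lt_integral_of_continuousOn_of_le_of_exists_lt
    (a := 0) (b := 1)
    (f := fun x : ℝ => x ^ s' / (1 + x) ^ 2 - J / K * (x ^ s' / (1 + x) ^ 1))
    (g := fun x : ℝ => a ^ (s' - s) * (x ^ s / (1 + x) ^ 2)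
      - a ^ (s' - s) * (J / K) * (x ^ s / (1 + x) ^ 1)) zero_lt_one
    ((continuousOn_weightedMoment_integrand 2 hs').sub
      (continuousOn_const.mul (continuousOn_weightedMoment_integrand 1 hs')))
    ((continuousOn_const.mul (continuousOn_weightedMoment_integrand 2 hs)).sub
      (continuousOn_const.mul (continuousOn_weightedMoment_integrand 1 hs))) ?_ ?_
  · rw [intervalIntegral.integral_sub (intervalIntegrable_weightedMoment_integrand 2 hs')
      ((intervalIntegrable_weightedMoment_integrand 1 hs').const_mul _),
      intervalIntegral.integral_sub
      ((intervalIntegrable_weightedMoment_integrand 2 hs).const_mul _)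
      ((intervalIntegrable_weightedMoment_integrand 1 hs).const_mul _)] at hlt
    simp only [intervalIntegral.integral_const_mul] at hlt
    change weightedMoment 2 s' - J / K * weightedMoment 1 s'
      < a ^ (s' - s) * J - a ^ (s' - s) * (J / K) * K at hlt
    have h0 : a ^ (s' - s) * J - a ^ (s' - s) * (J / K) * K = 0 := by field_simp; simp
    rw [h0, sub_neg, div_mul_eq_mul_div, lt_div_iff₀ hK] at hlt
    exact hlt
  · intro x hx
    have hx0 := hx.1
    rw [← sub_nonneg, key x hx0]
    refine mul_nonneg (by positivity) ?_
    by_cases h : x = a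
    · simp [h]
    · exact (hpos x hx0 h).le
  · obtain ⟨x, hx0, hx1, hxa⟩ : ∃ x : ℝ, 0 < x ∧ x ≤ 1 ∧ x ≠ a := by
      by_cases h : a = 1
      · exact ⟨1 / 2, by norm_num, by norm_num, by rw [h]; norm_num⟩
      · exact ⟨1, one_pos, le_rfl, Ne.symm h⟩
    refine ⟨x, ⟨hx0.le, hx1⟩, ?_⟩
    rw [← sub_pos, key x hx0]
    exact mul_pos (by positivity) (hpos x hx0 hxa)

/-- The function `s ξ₀(s) / (1 - ξ₀(s))` is strictly decreasing on `(0, ∞)`. -/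
lemma mul_xi0_mul_one_sub_xi0_lt {s s' : ℝ} (hs : 0 < s) (hss : s < s') :
    s' * xi0 s' * (1 - xi0 s) < s * xi0 s * (1 - xi0 s') := by
  have hs' := hs.trans hss
  rw [one_sub_xi0 hs.le, one_sub_xi0 hs'.le, xi0_eq_two_mul_weightedMoment hs.le,
    xi0_eq_two_mul_weightedMoment hs'.le]
  have := mul_lt_mul_of_pos_left (weightedMoment_mul_lt hs.le hss)
    (show 0 < 4 * s * s' by positivity)
  linarith

/-- The composition of two sharp bounds is strictly weaker than the direct sharp bound. -/
lemma sharp_bound_composition_lt {s₀ s₁ s₂ : ℝ} (h0 : 0 < s₀) (h01 : s₀ < s₁) (h12 : s₁ < s₂) :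
    1 - (1 - s₀ / s₂) * xi0 s₀ <
      (1 - (1 - s₀ / s₁) * xi0 s₀) * (1 - (1 - s₁ / s₂) * xi0 s₁) := by
  have h1 := h0.trans h01
  have h2 := h1.trans h12
  have key := mul_xi0_mul_one_sub_xi0_lt h0 h01
  -- The gap factors, and its sign is that of the monotonicity inequality `key`.
  have hid : (1 - (1 - s₀ / s₁) * xi0 s₀) * (1 - (1 - s₁ / s₂) * xi0 s₁)
      - (1 - (1 - s₀ / s₂) * xi0 s₀) =
      (s₂ - s₁) / (s₂ * s₁) *
        (s₀ * xi0 s₀ * (1 - xi0 s₁) - s₁ * xi0 s₁ * (1 - xi0 s₀)) := by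
    field_simp
    ring
  rw [← sub_pos, hid]
  exact mul_pos (div_pos (sub_pos.2 h12) (by positivity)) (sub_pos.2 key)

/-! ### Harnack's inequality. -/

/-- **Harnack's inequality** (lower bound) on the unit disk. -/
lemma harnack_lower {φ : ℂ → ℂ} (hd : DifferentiableOn ℂ φ (Metric.ball 0 1)) (h0 : φ 0 = 1)
    (hre : ∀ z ∈ Metric.ball (0 : ℂ) 1, 0 ≤ (φ z).re) {z : ℂ} (hz : z ∈ Metric.ball (0 : ℂ) 1) :
    (1 - ‖z‖) / (1 + ‖z‖) ≤ (φ z).re := by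
  have hne : ∀ w ∈ Metric.ball (0 : ℂ) 1, φ w + 1 ≠ 0 := by
    intro w hw h
    have := congrArg Complex.re h
    simp at this
    linarith [hre w hw]
  have hr1 : ‖z‖ < 1 := mem_ball_zero_iff.1 hz
  have hr0 := norm_nonneg z
  -- Schwarz's lemma for the Cayley transform of `φ`, which maps the right half-plane to the disk
  -- and `1` to `0`.
  have hS : ‖(φ z - 1) / (φ z + 1)‖ ≤ ‖z‖ := by
    refine Complex.norm_le_norm_of_mapsTo_ball (R := 1) (f := fun w => (φ w - 1) / (φ w + 1))
      ((hd.sub_const 1).div (hd.add_const 1) hne) ?_ (by simp [h0]) hr1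
    intro w hw
    rw [mem_closedBall_zero_iff, norm_div, div_le_one (norm_pos_iff.2 (hne w hw))]
    rw [← sq_le_sq₀ (norm_nonneg _) (norm_nonneg _), Complex.sq_norm, Complex.sq_norm,
      Complex.normSq_apply, Complex.normSq_apply]
    simp
    nlinarith [hre w hw]
  rw [norm_div, div_le_iff₀ (norm_pos_iff.2 (hne z hz))] at hS
  have hS2 : ‖φ z - 1‖ ^ 2 ≤ ‖z‖ ^ 2 * ‖φ z + 1‖ ^ 2 := by
    rw [← mul_pow]
    exact pow_le_pow_left₀ (norm_nonneg _) hS 2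
  rw [Complex.sq_norm (φ z - 1), Complex.sq_norm (φ z + 1), Complex.normSq_apply,
    Complex.normSq_apply] at hS2
  simp at hS2
  have hu := hre z hz
  generalize (φ z).re = u at *
  generalize (φ z).im = v at *
  generalize ‖z‖ = r at *
  have hrr : r ^ 2 ≤ 1 := by nlinarith
  -- The imaginary part contributes `(1 - r^2) v^2 ≥ 0` to the smaller side and can be dropped.
  have h3 : (1 - u) ^ 2 ≤ (r * (u + 1)) ^ 2 := by
    nlinarith [mul_nonneg (sub_nonneg.2 hrr) (sq_nonneg v)]
  have h4 := (abs_le_of_sq_le_sq' h3 (by positivity)).2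
  rw [div_le_iff₀ (by positivity)]
  linarith

lemma harnack_lower_of_le {g : ℂ → ℂ} {t : ℝ} (ht : t < 1)
    (hd : DifferentiableOn ℂ g (Metric.ball 0 1)) (h0 : g 0 = 1)
    (hre : ∀ z ∈ Metric.ball (0 : ℂ) 1, t ≤ (g z).re) {z : ℂ} (hz : z ∈ Metric.ball (0 : ℂ) 1) :
    t + (1 - t) * ((1 - ‖z‖) / (1 + ‖z‖)) ≤ (g z).re := by
  have ht' : 0 < 1 - t := sub_pos.2 ht
  have hre' : ∀ w, (((1 - t : ℝ) : ℂ)⁻¹ * (g w - t)).re = (1 - t)⁻¹ * ((g w).re - t) := by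
    intro w
    rw [← Complex.ofReal_inv, Complex.re_ofReal_mul]
    simp
  have h := harnack_lower (φ := fun w => ((1 - t : ℝ) : ℂ)⁻¹ * (g w - t))
    ((hd.sub_const _).const_mul _) ?_ ?_ hz
  · rw [hre', ← div_eq_inv_mul, le_div_iff₀ ht'] at h
    linarith
  · have : ((1 - t : ℝ) : ℂ) ≠ 0 := by exact_mod_cast ht'.ne'
    rw [h0]
    push_cast at this ⊢
    exact inv_mul_cancel₀ this
  · intro w hw
    rw [hre']
    exact mul_nonneg (inv_nonneg.2 ht'.le) (sub_nonneg.2 (hre w hw))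

/-! ### Estimates along radii. -/

lemma ofReal_mul_mem_ball {z : ℂ} (hz : z ∈ Metric.ball (0 : ℂ) 1) {x : ℝ} (hx : x ∈ Icc (0 : ℝ) 1) :
    (x : ℂ) * z ∈ Metric.ball (0 : ℂ) 1 := by
  rw [mem_ball_zero_iff] at *
  rw [norm_mul, Complex.norm_real, Real.norm_of_nonneg hx.1]
  exact (mul_le_of_le_one_left (norm_nonneg _) hx.2).trans_lt hz

lemma hasDerivAt_re_ray {p : ℂ → ℂ} (hd : DifferentiableOn ℂ p (Metric.ball 0 1)) {z : ℂ}
    (hz : z ∈ Metric.ball (0 : ℂ) 1) {x : ℝ} (hx : x ∈ Icc (0 : ℝ) 1) :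
    HasDerivAt (fun y : ℝ => (p (y * z)).re) (z * deriv p (x * z)).re x := by
  have hp := (hd.differentiableAt
    (Metric.isOpen_ball.mem_nhds (ofReal_mul_mem_ball hz hx))).hasDerivAt
  have hl : HasDerivAt (fun w : ℂ => w * z) z (x : ℂ) := by
    simpa using (hasDerivAt_id (x : ℂ)).mul_const z
  have h := (HasDerivAt.comp (x : ℂ) hp hl).real_of_complex
  rw [mul_comm] at h
  exact h

lemma continuousOn_comp_ray {p : ℂ → ℂ} (hp : ContinuousOn p (Metric.ball 0 1)) {z : ℂ}
    (hz : z ∈ Metric.ball (0 : ℂ) 1) : ContinuousOn (fun x : ℝ => p (x * z)) (Icc 0 1) :=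
  hp.comp (by fun_prop) fun _ hx => ofReal_mul_mem_ball hz hx

/-- The integrand is the `x`-derivative of `x^s Re p(xz)`; this recovers `p` from `p + z p'/s`. -/
lemma re_eq_integral_ray {p : ℂ → ℂ} (hd : DifferentiableOn ℂ p (Metric.ball 0 1)) {s : ℝ}
    (hs : 0 < s) {z : ℂ} (hz : z ∈ Metric.ball (0 : ℂ) 1) :
    ∫ x in (0 : ℝ)..1, s * x ^ (s - 1) * ((p (x * z)).re + (x * z * deriv p (x * z)).re / s)
      = (p z).re := by
  have hd' := (hd.deriv Metric.isOpen_ball).continuousOn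
  have h := integral_rpow_weight_mul_add hs (u := fun x : ℝ => (p (x * z)).re)
    (u' := fun x : ℝ => (z * deriv p (x * z)).re)
    (Complex.continuous_re.comp_continuousOn (continuousOn_comp_ray hd.continuousOn hz))
    (fun x hx => hasDerivAt_re_ray hd hz (Ioo_subset_Icc_self hx))
    (Complex.continuous_re.comp_continuousOn
      (continuousOn_const.mul (continuousOn_comp_ray hd' hz)))
  simp only [Complex.ofReal_one, one_mul] at h
  rw [← h]
  simp only [mul_assoc, Complex.re_ofReal_mul]

/-- If `Re (p + z p' / s) ≥ t`, then `Re p` is bounded below by means of `ξ₀(s)`. -/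
lemma xi0_bound_le_re {p : ℂ → ℂ} (hd : DifferentiableOn ℂ p (Metric.ball 0 1)) (h0 : p 0 = 1)
    {s t : ℝ} (hs : 0 < s) (ht : t < 1)
    (hre : ∀ z ∈ Metric.ball (0 : ℂ) 1, t ≤ (p z).re + (z * deriv p z).re / s)
    {z : ℂ} (hz : z ∈ Metric.ball (0 : ℂ) 1) :
    t + (1 - t) * xi0 s ≤ (p z).re := by
  have hd' := hd.deriv Metric.isOpen_ball
  have hgre : ∀ w, (p w + w * deriv p w / s).re = (p w).re + (w * deriv p w).re / s := by
    intro w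
    rw [Complex.add_re, Complex.div_ofReal_re]
  have hg : DifferentiableOn ℂ (fun w => p w + w * deriv p w / s) (Metric.ball 0 1) :=
    hd.add ((differentiableOn_id.mul hd').div_const _)
  -- Since `‖xz‖ ≤ x` and `(1 - r)/(1 + r)` decreases, the Harnack bound at `xz` can be made
  -- independent of `z`.
  have hH : ∀ x ∈ Icc (0 : ℝ) 1, t + (1 - t) * ((1 - x) / (1 + x)) ≤
      (p (x * z)).re + (x * z * deriv p (x * z)).re / s := by
    intro x hx
    have hm := ofReal_mul_mem_ball hz hx
    have h := harnack_lower_of_le ht hg (by simp [h0]) (fun w hw => by rw [hgre]; exact hre w hw) hm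
    rw [hgre] at h
    refine le_trans ?_ h
    have hn : ‖(x : ℂ) * z‖ ≤ x := by
      rw [norm_mul, Complex.norm_real, Real.norm_of_nonneg hx.1]
      exact mul_le_of_le_one_right hx.1 (mem_ball_zero_iff.1 hz).le
    have hx0 := hx.1
    have hx1 := hx.2
    have : 0 < 1 - t := sub_pos.2 ht
    gcongr
    linarith
  rw [← re_eq_integral_ray hd hs hz]
  have hc : ContinuousOn (fun x : ℝ => t + (1 - t) * ((1 - x) / (1 + x))) (Icc 0 1) :=
    continuousOn_const.add (continuousOn_const.mul continuousOn_one_sub_div_one_add)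
  have hl : ∫ x in (0 : ℝ)..1, s * x ^ (s - 1) * (t + (1 - t) * ((1 - x) / (1 + x)))
      = t + (1 - t) * xi0 s := by
    simp only [mul_add]
    rw [intervalIntegral.integral_add
      (intervalIntegrable_rpow_weight hs (φ := fun _ => t) continuousOn_const)
      (intervalIntegrable_rpow_weight hs (φ := fun x => (1 - t) * ((1 - x) / (1 + x)))
        (continuousOn_const.mul continuousOn_one_sub_div_one_add)),
      intervalIntegral.integral_mul_const, integral_rpow_weight hs, one_mul, xi0_of_pos hs,
      ← intervalIntegral.integral_const_mul]
    congr 2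
    ext x
    ring
  rw [← hl]
  have hcr : ContinuousOn
      (fun x : ℝ => (p (x * z)).re + (x * z * deriv p (x * z)).re / s) (Icc 0 1) := by
    have := Complex.continuous_re.comp_continuousOn (continuousOn_comp_ray hg.continuousOn hz)
    simpa only [Function.comp_def, hgre] using this
  refine intervalIntegral.integral_mono_on zero_le_one (intervalIntegrable_rpow_weight hs hc)
    (intervalIntegrable_rpow_weight hs hcr) ?_
  intro x hx
  have := hx.1
  have := hH x hx
  gcongr

/-- Replaces the integral bound when `s = 0`: `x` times the derivative of `Re p(xz)` in `x` is `Re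
(w p'(w))` at `w = xz`. -/
lemma one_le_re_of_radial_monotone {p : ℂ → ℂ} (hd : DifferentiableOn ℂ p (Metric.ball 0 1))
    (h0 : p 0 = 1) (hre : ∀ z ∈ Metric.ball (0 : ℂ) 1, 0 ≤ (z * deriv p z).re)
    {z : ℂ} (hz : z ∈ Metric.ball (0 : ℂ) 1) : 1 ≤ (p z).re := by
  have hm : MonotoneOn (fun x : ℝ => (p (x * z)).re) (Icc 0 1) := by
    refine monotoneOn_of_hasDerivWithinAt_nonneg (convex_Icc 0 1)
      (f' := fun x : ℝ => (z * deriv p (x * z)).re)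
      (Complex.continuous_re.comp_continuousOn (continuousOn_comp_ray hd.continuousOn hz))
      (fun x hx => (hasDerivAt_re_ray hd hz (interior_subset hx)).hasDerivWithinAt) ?_
    intro x hx
    rw [interior_Icc] at hx
    have h := hre _ (ofReal_mul_mem_ball hz (Ioo_subset_Icc_self hx))
    rw [mul_assoc, Complex.re_ofReal_mul] at h
    exact nonneg_of_mul_nonneg_right h hx.1
  have := hm (left_mem_Icc.2 zero_le_one) (right_mem_Icc.2 zero_le_one) zero_le_one
  simpa [h0] using this

/-! ### The classes in terms of `p = f(z)/z`. -/

lemma deriv_id_mul {p : ℂ → ℂ} (hd : DifferentiableOn ℂ p (Metric.ball 0 1)) {z : ℂ}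
    (hz : z ∈ Metric.ball (0 : ℂ) 1) :
    deriv (fun w => w * p w) z = p z + z * deriv p z := by
  have hp := (hd.differentiableAt (Metric.isOpen_ball.mem_nhds hz)).hasDerivAt
  simpa using ((hasDerivAt_id' z).fun_mul hp).deriv

/-- Membership in `𝔄_s^t` in terms of `p(z) = f(z) / z`. -/
lemma id_mul_mem_classA_iff {p : ℂ → ℂ} (hd : DifferentiableOn ℂ p (Metric.ball 0 1))
    (h0 : p 0 = 1) {s t : ℝ} :
    (fun z => z * p z) ∈ classA s t ↔
      ∀ z ∈ Metric.ball (0 : ℂ) 1, z ≠ 0 → s * t ≤ s * (p z).re + (z * deriv p z).re := by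
  have hn : (fun z => z * p z) ∈ normalizedClass :=
    ⟨differentiableOn_id.mul hd, by simp, by
      rw [deriv_id_mul hd (Metric.mem_ball_self one_pos)]; simp [h0]⟩
  have hval : ∀ z ∈ Metric.ball (0 : ℂ) 1, z ≠ 0 →
      (((s : ℂ) - 1) * (z * p z / z) + deriv (fun z => z * p z) z).re
        = s * (p z).re + (z * deriv p z).re := by
    intro z hz hz0
    rw [deriv_id_mul hd hz, mul_div_cancel_left₀ _ hz0, ← Complex.re_ofReal_mul, ← Complex.add_re]
    congr 1
    ring
  constructor
  · intro h z hz hz0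
    rw [← hval z hz hz0]
    exact h.2 z hz hz0
  · intro h
    refine ⟨hn, fun z hz hz0 => ?_⟩
    rw [hval z hz hz0]
    exact h z hz hz0

lemma exists_eq_id_mul {f : ℂ → ℂ} (hf : f ∈ normalizedClass) :
    ∃ p : ℂ → ℂ, DifferentiableOn ℂ p (Metric.ball 0 1) ∧ p 0 = 1 ∧ f = fun z => z * p z := by
  obtain ⟨hd, h0, h1⟩ := hf
  refine ⟨dslope f 0, (Complex.differentiableOn_dslope (Metric.ball_mem_nhds _ one_pos)).2 hd,
    by rw [dslope_same, h1], ?_⟩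
  ext z
  have := sub_smul_dslope f 0 z
  simp only [sub_zero, h0, smul_eq_mul] at this
  exact this.symm

/-! ### The extremal function. -/

/-- The solution `q = 1 + ∑ 2s/(s+n) zⁿ` of `s q + z q' = s (1 + z) / (1 - z)`. -/
lemma exists_extremal {s : ℝ} (hs : 0 < s) :
    ∃ q : ℂ → ℂ, DifferentiableOn ℂ q (Metric.ball 0 1) ∧ q 0 = 1 ∧
      ∀ z ∈ Metric.ball (0 : ℂ) 1, s * q z + z * deriv q z = s * ((1 + z) / (1 - z)) := by
  set F : ℕ → ℂ → ℂ := fun n z => (2 * s / (s + n) : ℝ) * z ^ n with hF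
  have hFd : ∀ n z, HasDerivAt (F n) ((2 * s / (s + n) : ℝ) * (n * z ^ (n - 1))) z :=
    fun n z => (hasDerivAt_pow n z).const_mul _
  have hFdo : ∀ n U, DifferentiableOn ℂ (F n) U :=
    fun n U z _ => (hFd n z).differentiableAt.differentiableWithinAt
  have hb : ∀ ρ : ℝ, ∀ n : ℕ, ∀ w ∈ Metric.ball (0 : ℂ) ρ, ‖F n w‖ ≤ 2 * ρ ^ n := by
    intro ρ n w hw
    rw [mem_ball_zero_iff] at hw
    have hc : 2 * s / (s + n) ≤ 2 := by
      rw [div_le_iff₀ (by positivity)]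
      have : (0 : ℝ) ≤ n := n.cast_nonneg
      linarith
    rw [hF, norm_mul, Complex.norm_real, Real.norm_of_nonneg (by positivity), norm_pow]
    gcongr
  have hsum : ∀ ρ : ℝ, 0 < ρ → ρ < 1 → Summable fun n : ℕ => 2 * ρ ^ n :=
    fun ρ h0 h1 => (summable_geometric_of_lt_one h0.le h1).mul_left 2
  have hρ : ∀ z ∈ Metric.ball (0 : ℂ) 1, ∃ ρ : ℝ, 0 < ρ ∧ ρ < 1 ∧ z ∈ Metric.ball (0 : ℂ) ρ := by
    intro z hz
    rw [mem_ball_zero_iff] at hz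
    obtain ⟨ρ, h1, h2⟩ := exists_between hz
    exact ⟨ρ, (norm_nonneg z).trans_lt h1, h2, mem_ball_zero_iff.2 h1⟩
  have hdiff : ∀ z ∈ Metric.ball (0 : ℂ) 1, DifferentiableAt ℂ (fun w => ∑' n, F n w) z := by
    intro z hz
    obtain ⟨ρ, h0, h1, hzρ⟩ := hρ z hz
    exact (Complex.differentiableOn_tsum_of_summable_norm (hsum ρ h0 h1) (fun n => hFdo n _)
      Metric.isOpen_ball (hb ρ)).differentiableAt (Metric.isOpen_ball.mem_nhds hzρ)
  -- The term `n = 0` of the series is `2`, so `1` is subtracted to get `q 0 = 1`.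
  refine ⟨fun w => ∑' n, F n w - 1,
    fun z hz => ((hdiff z hz).sub_const 1).differentiableWithinAt, ?_, ?_⟩
  · have : ∑' n, F n 0 = F 0 0 := tsum_eq_single 0 fun n hn => by simp [hF, hn]
    simp only [this]
    simp [hF, hs.ne']
    norm_num
  · intro z hz
    obtain ⟨ρ, h0, h1, hzρ⟩ := hρ z hz
    have hz1 := mem_ball_zero_iff.1 hz
    have hA : HasSum (fun n => F n z) (∑' n, F n z) :=
      (Summable.of_norm_bounded (hsum ρ h0 h1) fun n => hb ρ n z hzρ).hasSum
    have hB := Complex.hasSum_deriv_of_summable_norm (hsum ρ h0 h1) (fun n => hFdo n _)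
      Metric.isOpen_ball (hb ρ) hzρ
    have hC := (hA.mul_left (s : ℂ)).add (hB.mul_left z)
    have hG := (hasSum_geometric_of_norm_lt_one hz1).mul_left (2 * s : ℂ)
    have hterm : ∀ n : ℕ, (s : ℂ) * F n z + z * deriv (F n) z = 2 * s * z ^ n := by
      intro n
      have hne : (s + n : ℂ) ≠ 0 := by
        have : (0 : ℝ) < s + n := by positivity
        exact_mod_cast this.ne'
      have hpow : z * (n * z ^ (n - 1)) = n * z ^ n := by
        cases n with
        | zero => simp
        | succ k => rw [Nat.add_sub_cancel, pow_succ]; ring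
      rw [(hFd n z).deriv, mul_left_comm z, hpow]
      simp only [hF]
      push_cast
      field_simp
    simp only [hterm] at hC
    have hE := hC.unique hG
    rw [deriv_sub_const, mul_sub, sub_add_eq_add_sub, hE]
    have hne : 1 - z ≠ 0 := by
      rw [sub_ne_zero]
      rintro rfl
      simp at hz1
    field_simp
    ring

lemma re_one_add_div_one_sub_nonneg {z : ℂ} (hz : z ∈ Metric.ball (0 : ℂ) 1) :
    0 ≤ ((1 + z) / (1 - z)).re := by
  have h1 : Complex.normSq z ≤ 1 := by
    rw [Complex.normSq_eq_norm_sq]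
    exact pow_le_one₀ (norm_nonneg _) (mem_ball_zero_iff.1 hz).le
  rw [Complex.normSq_apply] at h1
  rw [Complex.div_re, ← add_div]
  refine div_nonneg ?_ (Complex.normSq_nonneg _)
  simp
  linarith

/-- Near the boundary point `-1` the extremal function nearly attains `ξ₀(s)`. -/
lemma extremal_re_le {s : ℝ} (hs : 0 < s) {q : ℂ → ℂ}
    (hd : DifferentiableOn ℂ q (Metric.ball 0 1))
    (hq : ∀ z ∈ Metric.ball (0 : ℂ) 1, s * q z + z * deriv q z = s * ((1 + z) / (1 - z)))
    {r : ℝ} (hr : r ∈ Ioo (0 : ℝ) 1) :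
    (q (-r : ℝ)).re ≤ xi0 s + 2 * (1 - r) := by
  have hz : ((-r : ℝ) : ℂ) ∈ Metric.ball (0 : ℂ) 1 := by
    rw [mem_ball_zero_iff, Complex.norm_real, norm_neg, Real.norm_of_nonneg hr.1.le]
    exact hr.2
  have hval : ∀ x ∈ Icc (0 : ℝ) 1, (q (x * (-r : ℝ))).re
      + (x * (-r : ℝ) * deriv q (x * (-r : ℝ))).re / s = (1 - x * r) / (1 + x * r) := by
    intro x hx
    have h := congrArg Complex.re (hq _ (ofReal_mul_mem_ball hz hx))
    rw [Complex.add_re, Complex.re_ofReal_mul, Complex.re_ofReal_mul] at h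
    have h2 : ((1 + (x : ℂ) * (-r : ℝ)) / (1 - (x : ℂ) * (-r : ℝ))).re
        = (1 - x * r) / (1 + x * r) := by
      rw [← Complex.ofReal_re ((1 - x * r) / (1 + x * r))]
      congr 1
      push_cast
      ring
    rw [h2] at h
    generalize ((x : ℂ) * (-r : ℝ) * deriv q (x * (-r : ℝ))).re = d at *
    rw [← mul_right_inj' hs.ne', ← h]
    field_simp
  have hc : ContinuousOn (fun x : ℝ => (1 - x * r) / (1 + x * r)) (Icc 0 1) := by
    refine ContinuousOn.div (by fun_prop) (by fun_prop) ?_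
    intro x hx
    have := mul_nonneg hx.1 hr.1.le
    positivity
  have h2 : ContinuousOn (fun _ : ℝ => 2 * (1 - r)) (Icc 0 1) := continuousOn_const
  have hint : ∫ x in (0 : ℝ)..1, s * x ^ (s - 1) * ((1 - x * r) / (1 + x * r))
      = (q (-r : ℝ)).re := by
    rw [← re_eq_integral_ray hd hs hz]
    refine intervalIntegral.integral_congr fun x hx => ?_
    rw [uIcc_of_le zero_le_one] at hx
    simp only [hval x hx]
  have hxi : ∫ x in (0 : ℝ)..1, s * x ^ (s - 1) * ((1 - x) / (1 + x) + 2 * (1 - r))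
      = xi0 s + 2 * (1 - r) := by
    simp only [mul_add]
    rw [intervalIntegral.integral_add
      (intervalIntegrable_rpow_weight hs continuousOn_one_sub_div_one_add)
      (by simpa only [mul_add] using intervalIntegrable_rpow_weight hs h2),
      intervalIntegral.integral_mul_const, integral_rpow_weight hs, one_mul, xi0_of_pos hs]
  rw [← hint, ← hxi]
  refine intervalIntegral.integral_mono_on zero_le_one (intervalIntegrable_rpow_weight hs hc)
    (intervalIntegrable_rpow_weight hs (continuousOn_one_sub_div_one_add.add h2)) ?_
  intro x hx
  have hx0 := hx.1
  have hx1 := hx.2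
  have hr0 := hr.1
  have hr1 : 0 ≤ 1 - r := sub_nonneg.2 hr.2.le
  refine mul_le_mul_of_nonneg_left ?_ (by positivity)
  have h1 : 0 < 1 + x := by positivity
  have h3 : 0 < 1 + x * r := by positivity
  rw [← sub_nonneg]
  -- Replacing `xr` by `x` costs `2x(1 - r)/((1 + x)(1 + xr))`, which the slack `2(1 - r)` absorbs.
  have hid : (1 - x) / (1 + x) + 2 * (1 - r) - (1 - x * r) / (1 + x * r)
      = 2 * (1 - r) * (1 + x * r + x * (x * r)) / ((1 + x) * (1 + x * r)) := by
    field_simp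
    ring
  rw [hid]
  positivity

/-! ### The sharp inclusion and the theorem. -/

lemma classA_subset_of_pos {s₁ t₁ s₂ : ℝ} (hs₁ : 0 < s₁) (ht₁ : t₁ < 1) (hs : s₁ < s₂) :
    classA s₁ t₁ ⊆ classA s₂ (t₁ + (1 - t₁) * (1 - s₁ / s₂) * xi0 s₁) := by
  intro f hf
  obtain ⟨p, hd, h0, rfl⟩ := exists_eq_id_mul hf.1
  rw [id_mul_mem_classA_iff hd h0] at hf ⊢
  intro z hz _
  have hre : ∀ z ∈ Metric.ball (0 : ℂ) 1, t₁ ≤ (p z).re + (z * deriv p z).re / s₁ := by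
    intro z hz
    by_cases hz0 : z = 0
    · simp [hz0, h0, ht₁.le]
    · rw [← mul_le_mul_iff_right₀ hs₁, mul_add, mul_div_cancel₀ _ hs₁.ne']
      exact hf z hz hz0
  have h1 := xi0_bound_le_re hd h0 hs₁ ht₁ hre hz
  have h2 := hre z hz
  have hs₂ := hs₁.trans hs
  generalize (z * deriv p z).re = d at *
  have e1 : s₂ * (t₁ + (1 - t₁) * (1 - s₁ / s₂) * xi0 s₁)
      = s₁ * t₁ + (s₂ - s₁) * (t₁ + (1 - t₁) * xi0 s₁) := by
    field_simp
    ring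
  have e2 : s₂ * (p z).re + d = s₁ * ((p z).re + d / s₁) + (s₂ - s₁) * (p z).re := by
    field_simp
    ring
  rw [e1, e2]
  have := sub_nonneg.2 hs.le
  gcongr

lemma classA_zero_subset {t₁ s₂ : ℝ} (hs : 0 < s₂) : classA 0 t₁ ⊆ classA s₂ 1 := by
  intro f hf
  obtain ⟨p, hd, h0, rfl⟩ := exists_eq_id_mul hf.1
  rw [id_mul_mem_classA_iff hd h0] at hf ⊢
  have hre : ∀ z ∈ Metric.ball (0 : ℂ) 1, 0 ≤ (z * deriv p z).re := by
    intro z hz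
    by_cases hz0 : z = 0
    · simp [hz0]
    · simpa using hf z hz hz0
  intro z hz _
  have h1 := one_le_re_of_radial_monotone hd h0 hre hz
  have h2 := hre z hz
  have := mul_le_mul_of_nonneg_left h1 hs.le
  linarith

/-- The identity `f(z) = z`, that is `p = 1`, is the test function. -/
lemma le_one_of_classA_zero_subset {t₁ s₂ t : ℝ} (hs : 0 < s₂)
    (h : classA 0 t₁ ⊆ classA s₂ t) : t ≤ 1 := by
  have h1 := h ((id_mul_mem_classA_iff (p := fun _ => 1) (differentiableOn_const _) rfl).2
    (by simp))
  rw [id_mul_mem_classA_iff (p := fun _ => 1) (differentiableOn_const _) rfl] at h1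
  have h2 := h1 (1 / 2) (by rw [mem_ball_zero_iff]; norm_num) (by norm_num)
  have h3 : s₂ * t ≤ s₂ * 1 := by simpa using h2
  exact le_of_mul_le_mul_left h3 hs

lemma le_of_classA_subset_of_pos {s₁ t₁ s₂ t : ℝ} (hs₁ : 0 < s₁) (ht₁ : t₁ < 1) (hs : s₁ < s₂)
    (h : classA s₁ t₁ ⊆ classA s₂ t) : t ≤ t₁ + (1 - t₁) * (1 - s₁ / s₂) * xi0 s₁ := by
  obtain ⟨q, hd, h0, hq⟩ := exists_extremal hs₁
  have ht : 0 < 1 - t₁ := sub_pos.2 ht₁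
  have hs₂ := hs₁.trans hs
  -- The affine rescaling of `q` for which `Re (p + z p'/s₁)` has infimum `t₁`; it is tested at `z =
  -- -r` with `r → 1`.
  set p : ℂ → ℂ := fun z => t₁ + (1 - t₁ : ℝ) * q z with hp
  have hpd : DifferentiableOn ℂ p (Metric.ball 0 1) := (hd.const_mul _).const_add _
  have hp0 : p 0 = 1 := by simp [hp, h0]
  have hpre : ∀ z, (p z).re = t₁ + (1 - t₁) * (q z).re := by
    intro z
    rw [hp, Complex.add_re, Complex.re_ofReal_mul, Complex.ofReal_re]
  have hpder : ∀ z ∈ Metric.ball (0 : ℂ) 1,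
      (z * deriv p z).re = (1 - t₁) * (z * deriv q z).re := by
    intro z hz
    have hqz := (hd.differentiableAt (Metric.isOpen_ball.mem_nhds hz)).hasDerivAt
    rw [((hqz.const_mul _).const_add _).deriv, mul_left_comm, Complex.re_ofReal_mul]
  have hqre : ∀ z ∈ Metric.ball (0 : ℂ) 1,
      s₁ * (q z).re + (z * deriv q z).re = s₁ * ((1 + z) / (1 - z)).re := by
    intro z hz
    rw [← Complex.re_ofReal_mul, ← Complex.re_ofReal_mul, ← Complex.add_re, hq z hz]
  have hmem : (fun z => z * p z) ∈ classA s₁ t₁ := by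
    rw [id_mul_mem_classA_iff hpd hp0]
    intro z hz _
    have h1 := mul_nonneg (mul_nonneg hs₁.le ht.le) (re_one_add_div_one_sub_nonneg hz)
    rw [hpre, hpder z hz]
    linear_combination h1 - (1 - t₁) * hqre z hz
  have hbound : ∀ r ∈ Ioo (0 : ℝ) 1, s₂ * t ≤ s₂ * t₁ + (1 - t₁) *
      ((s₂ - s₁) * (xi0 s₁ + 2 * (1 - r)) + s₁ * (1 - r)) := by
    intro r hr
    have hr0 := hr.1
    have hz : ((-r : ℝ) : ℂ) ∈ Metric.ball (0 : ℂ) 1 := by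
      rw [mem_ball_zero_iff, Complex.norm_real, norm_neg, Real.norm_of_nonneg hr.1.le]
      exact hr.2
    have h1 := (id_mul_mem_classA_iff hpd hp0).1 (h hmem) _ hz
      (Complex.ofReal_ne_zero.2 (neg_ne_zero.2 hr.1.ne'))
    rw [hpre, hpder _ hz] at h1
    have h2 := hqre _ hz
    have h3 : ((1 + ((-r : ℝ) : ℂ)) / (1 - ((-r : ℝ) : ℂ))).re ≤ 1 - r := by
      have : (1 + ((-r : ℝ) : ℂ)) / (1 - ((-r : ℝ) : ℂ)) = (((1 - r) / (1 + r) : ℝ) : ℂ) := by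
        push_cast
        ring
      rw [this, Complex.ofReal_re]
      exact div_le_self (sub_nonneg.2 hr.2.le) (by linarith)
    have h4 := extremal_re_le hs₁ hd hq hr
    have h5 := mul_le_mul_of_nonneg_left
      (add_le_add (mul_le_mul_of_nonneg_left h4 (sub_nonneg.2 hs.le))
        (mul_le_mul_of_nonneg_left h3 hs₁.le)) ht.le
    linear_combination h1 + h5 + (1 - t₁) * h2
  have hlim : s₂ * t ≤ s₂ * t₁ + (1 - t₁) *
      ((s₂ - s₁) * (xi0 s₁ + 2 * (1 - 1)) + s₁ * (1 - 1)) := by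
    have hcont : Continuous fun r : ℝ => s₂ * t₁ + (1 - t₁) *
      ((s₂ - s₁) * (xi0 s₁ + 2 * (1 - r)) + s₁ * (1 - r)) := by fun_prop
    refine ge_of_tendsto ((hcont.tendsto 1).mono_left (nhdsWithin_le_nhds (s := Iio 1))) ?_
    filter_upwards [Ioo_mem_nhdsLT (zero_lt_one' ℝ)] with r hr
    exact hbound r hr
  refine le_of_mul_le_mul_left (hlim.trans_eq ?_) hs₂
  field_simp
  ring

lemma sharpInclusion_xi0 {s₁ t₁ s₂ : ℝ} (hs₁ : 0 ≤ s₁) (ht₁ : t₁ < 1) (hs : s₁ < s₂) :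
    SharpInclusion s₁ t₁ s₂ (t₁ + (1 - t₁) * (1 - s₁ / s₂) * xi0 s₁) := by
  rcases hs₁.eq_or_lt with rfl | hs₁
  · have : t₁ + (1 - t₁) * (1 - 0 / s₂) * xi0 0 = 1 := by simp [xi0]
    rw [this]
    exact ⟨classA_zero_subset hs, fun t ht h => ht.not_ge (le_one_of_classA_zero_subset hs h)⟩
  · exact ⟨classA_subset_of_pos hs₁ ht₁ hs,
      fun t ht h => ht.not_ge (le_of_classA_subset_of_pos hs₁ ht₁ hs h)⟩

theorem theorem3p3 (s₁ t₁ s₂ : ℝ) (hs₁ : 0 ≤ s₁) (ht₁ : t₁ ∈ Ico (0 : ℝ) 1) (hs : s₁ < s₂) :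
    SharpInclusion s₁ t₁ s₂ (t₁ + (1 - t₁) * (1 - s₁ / s₂) * xi0 s₁) ∧
    (∀ t₂ : ℝ, classA s₁ t₁ ⊆ classA s₂ t₂ →
      t₂ ≤ t₁ + (1 - t₁) * (1 - s₁ / s₂) * xi0 s₁ ∧ (1 - t₁) * s₁ ≤ (1 - t₂) * s₂) ∧
    (∀ s₀ ∈ Ico (0 : ℝ) s₁, ∀ t₀ ∈ Ico (0 : ℝ) 1, ∀ t₂ ∈ Ico (0 : ℝ) 1,
      classA s₀ t₀ ⊆ classA s₁ t₁ → classA s₁ t₁ ⊆ classA s₂ t₂ →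
      ¬ SharpInclusion s₀ t₀ s₂ t₂) := by
  have hsharp := sharpInclusion_xi0 hs₁ ht₁.2 hs
  have hs₂ := hs₁.trans_lt hs
  have ht : 0 < 1 - t₁ := sub_pos.2 ht₁.2
  have hle : ∀ t₂ : ℝ, classA s₁ t₁ ⊆ classA s₂ t₂ →
      t₂ ≤ t₁ + (1 - t₁) * (1 - s₁ / s₂) * xi0 s₁ :=
    fun t₂ h => not_lt.1 fun hlt => hsharp.2 t₂ hlt h
  refine ⟨hsharp, fun t₂ h => ⟨hle t₂ h, ?_⟩, ?_⟩
  · have h1 := mul_le_mul_of_nonneg_right (hle t₂ h) hs₂.le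
    have e1 : (t₁ + (1 - t₁) * (1 - s₁ / s₂) * xi0 s₁) * s₂
        = t₁ * s₂ + (1 - t₁) * ((s₂ - s₁) * xi0 s₁) := by
      field_simp
    -- Putting `1` for `ξ₀(s₁)` turns the sharp bound into `(1 - t₁) s₁ ≤ (1 - t₂) s₂`.
    have h2 := mul_le_mul_of_nonneg_left
      (mul_le_mul_of_nonneg_left (xi0_le_one hs₁) (sub_nonneg.2 hs.le)) ht.le
    linarith
  · rintro s₀ ⟨hs₀, hs₀₁⟩ t₀ ⟨_, ht₀⟩ t₂ ht₂ h01 h12 ⟨_, hmax⟩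
    have h02 := sharpInclusion_xi0 hs₀ ht₀ (hs₀₁.trans hs)
    -- If the composed inclusion were sharp, `t₂` would reach the direct bound. For `s₀ = 0` that
    -- bound is `1 > t₂`; otherwise `1 - t₂` is at least `1 - t₀` times the product of two factors,
    -- which is too large.
    have hge : t₀ + (1 - t₀) * (1 - s₀ / s₂) * xi0 s₀ ≤ t₂ :=
      not_lt.1 fun hlt => hmax _ hlt h02.1
    rcases hs₀.eq_or_lt with rfl | hs₀
    · have : t₀ + (1 - t₀) * (1 - 0 / s₂) * xi0 0 = 1 := by simp [xi0]
      linarith [ht₂.2]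
    have ha : t₁ ≤ t₀ + (1 - t₀) * (1 - s₀ / s₁) * xi0 s₀ :=
      not_lt.1 fun hlt => (sharpInclusion_xi0 hs₀.le ht₀ hs₀₁).2 _ hlt h01
    have hb := hle t₂ h12
    have hβ : 0 ≤ 1 - (1 - s₁ / s₂) * xi0 s₁ := by
      have h1 : 0 ≤ s₁ / s₂ := by positivity
      have h2 := xi0_pos hs₁
      have h3 := mul_nonneg h1 h2.le
      linarith [xi0_le_one hs₁]
    have ha' : (1 - t₀) * (1 - (1 - s₀ / s₁) * xi0 s₀) ≤ 1 - t₁ := by linarith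
    have hprod := mul_le_mul_of_nonneg_right ha' hβ
    have hstrict := mul_lt_mul_of_pos_left (sharp_bound_composition_lt hs₀ hs₀₁ hs)
      (sub_pos.2 ht₀)
    linarith
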